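/- For $n\ge 1$ let $[n]=\{1,\dots,n\}$, let $S_n$ be the set of permutations of $[n]$, and for a sequence of integers $a=a_1a_2\cdots a_n$ let $D(a)=\{i : 1\le i\le n-1,\ a_i>a_{i+1}\}$ be its descent set; for $\sigma\in S_n$ let $D(\sigma)$ be the descent set of its one-line notation $\sigma(1)\sigma(2)\cdots\sigma(n)$. Let $\mathcal T^0_n$ be the set of all sequences obtained from the one-line notation of an $n$-cycle in $S_n$ (a permutation consisting of one single cycle of length $n$; for $n=1$ this is the identity) by replacing one entry with $0$. Then for every $n\ge 1$ there is a bijection $\varphi:\mathcal T^0_n\to S_n$ such that, for every $\tau\in\mathcal T^0_n$ with image $\sigma=\varphi(\tau)$, we have $D(\tau)=D(\sigma)$ and, if $0$ is in position $k$ of $\tau$, then $\sigma(k)=1$. Consequently (Elizalde's conjecture), for every $I\subseteq[n-1]$, $$|\{\tau\in\mathcal T^0_n : D(\tau)=I\}|=|\{\sigma\in S_n : D(\sigma)=I\}|.$$ -/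

import Mathlib

namespace CyclicDescent

/-- The one-line notation `π(1) π(2) ⋯ π(n)` of a permutation `π ∈ S_n`, as a sequence of integers.
Positions and elements `0, …, n - 1` of `Fin n` stand for `1, …, n`, so position `j : Fin n` is the
`(j + 1)`-st position, and the entries are shifted by one so as to lie in `{1, …, n}`. -/
def oneLine {n : ℕ} (π : Equiv.Perm (Fin n)) : Fin n → ℤ :=
  fun j => ((π j : ℕ) : ℤ) + 1

/-- The descent set `{i : 1 ≤ i ≤ n - 1, a_i > a_{i+1}}` of a sequence of integers `a_1 ⋯ a_n`.
The entry `a_i` is `a ⟨i - 1, _⟩`, and `a_{i+1}` is `a ⟨i, _⟩`. -/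
def descentSet {n : ℕ} (a : Fin n → ℤ) : Set ℕ :=
  {i | ∃ (_ : 1 ≤ i) (h : i < n), a ⟨i - 1, lt_of_le_of_lt (Nat.sub_le i 1) h⟩ > a ⟨i, h⟩}

/-- `π ∈ S_n` is an `n`-cycle: it consists of a single cycle through all `n` elements. For `n = 1`
this includes the identity (a single cycle of length one). -/
def IsFullCycle {n : ℕ} (π : Equiv.Perm (Fin n)) : Prop :=
  π.IsCycleOn Set.univ

/-- The set `T⁰_n` of the sequences obtained from the one-line notation of an `n`-cycle by replacing
one entry with `0`. -/
def T0 (n : ℕ) : Set (Fin n → ℤ) :=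
  {τ | ∃ π : Equiv.Perm (Fin n), IsFullCycle π ∧ ∃ k : Fin n, τ = Function.update (oneLine π) k 0}

end CyclicDescent

/-!
A permutation `u` of `Fin n` spells two sequences: the one-line notation of `u⁻¹`, and the `n`-cycle
`(u 0, u 1, …, u (n - 1))` with its entry in position `k = u 0` replaced by `0`. Both have their
minimum at position `k`. Colour the positions by blocks of consecutive positions, with `k` alone in
its block. A descent set lies in a prescribed set `J` iff the sequence increases on the blocks
obtained by cutting at `J` and around `k` (and `J` contains the descent into `k`).

Write `w = c ∘ u` for the word of colours. Then `u⁻¹` increases on the blocks iff it is the stable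
sorting permutation of `w`, while the cycle increases on them iff `u⁻¹` sorts the cyclic rotations
of `w` lexicographically, since the rotation of `w` starting at `i` is the sequence of colours met
when iterating the cycle from `u i`. Both sorting permutations rearrange `w` into `c`, so in either
case `u` can be recovered from `w`, and the two families of `u` are equinumerous. Möbius inversion
over `J` passes from descent sets contained in `J` to descent sets equal to `J`.
-/

namespace CyclicDescent

open Equiv Finset Function

/-- The function `f` is strictly increasing on every colour class of the colouring `c`. -/
def StrictMonoOnFibers {α β κ : Type*} [Preorder α] [Preorder β] (c : α → κ) (f : α → β) : Prop :=
  ∀ ⦃x y⦄, x < y → c x = c y → f x < f y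

theorem strictMonoOnFibers_update_iff {α β κ : Type*} [DecidableEq α] [Preorder α] [Preorder β]
    {c : α → κ} {k : α} (hck : ∀ x, c x = c k → x = k) (f : α → β) (b : β) :
    StrictMonoOnFibers c (update f k b) ↔ StrictMonoOnFibers c f := by
  refine forall₄_congr fun x y hxy hcxy => ?_
  have hx : x ≠ k := fun hx => hxy.ne' (hx ▸ hck y (hx ▸ hcxy.symm))
  have hy : y ≠ k := fun hy => hxy.ne (hy ▸ hck x (hy ▸ hcxy))
  rw [update_of_ne hx, update_of_ne hy]

section Itinerary

variable {α κ : Type*} {c : α → κ} {f : α → α} {k x y : α}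

/-- The itinerary of `x` under `f`: the infinite word of colours met along the orbit of `x`.
Itineraries are compared lexicographically. -/
def itinerary (c : α → κ) (f : α → α) (x : α) : Lex (ℕ → κ) :=
  toLex fun m => c (f^[m] x)

theorem itinerary_apply_of_semiconj {β : Type*} {u : β → α} {g : β → β} (h : Semiconj u g f)
    (i : β) : itinerary c f (u i) = itinerary (c ∘ u) g i :=
  congrArg toLex <| funext fun m => congrArg c ((h.iterate_right m).eq i).symm

theorem itinerary_injective (hf : Injective f) (hck : ∀ x, c x = c k → x = k)
    (hreach : ∀ x, ∃ m, f^[m] x = k) : Injective (itinerary c f) := by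
  intro x y hxy
  obtain ⟨m, hm⟩ := hreach x
  have hcm : c (f^[m] x) = c (f^[m] y) := congrFun (congrArg ofLex hxy) m
  exact hf.iterate m (hm.trans (hck _ (hm ▸ hcm.symm)).symm)

theorem apply_le_of_itinerary_le [LinearOrder κ] (h : itinerary c f x ≤ itinerary c f y) :
    c x ≤ c y :=
  Pi.apply_le_of_toLex (x := fun m => c (f^[m] x)) (i := 0) h (by simp)

theorem itinerary_apply_lt_of_lt [Preorder κ] (h : itinerary c f x < itinerary c f y)
    (hxy : c x = c y) : itinerary c f (f x) < itinerary c f (f y) := by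
  obtain ⟨m, hagree, hlt⟩ := h
  cases m with
  | zero => exact absurd hxy hlt.ne
  | succ m => exact ⟨m, fun l hl => hagree (l + 1) (Nat.succ_lt_succ hl), hlt⟩

theorem StrictMonoOnFibers.monotone_itinerary [PartialOrder α] [LinearOrder κ] (hc : Monotone c)
    (hf : StrictMonoOnFibers c f) : Monotone (itinerary c f) := by
  refine monotone_iff_forall_lt.2 fun x y hxy => not_lt.1 ?_
  rintro ⟨m, hagree, hlt⟩
  have horbit : ∀ l ≤ m, f^[l] x < f^[l] y := by
    intro l hl
    induction l with
    | zero => exact hxy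
    | succ l ih =>
      rw [iterate_succ_apply', iterate_succ_apply']
      exact hf (ih (by omega)) (hagree l hl).symm
  exact (hc (horbit m le_rfl).le).not_gt hlt

theorem strictMonoOnFibers_of_strictMono_itinerary [LinearOrder α] [PartialOrder κ]
    (h : StrictMono (itinerary c f)) : StrictMonoOnFibers c f :=
  fun _ _ hxy hcxy => h.lt_iff_lt.1 (itinerary_apply_lt_of_lt (h hxy) hcxy)

end Itinerary

section FullCycle

variable {n : ℕ} [NeZero n]

/-- The `n`-cycle `(u 0, u 1, …, u (n - 1))`, in cycle notation. -/
def fullCycle (u : Perm (Fin n)) : Perm (Fin n) :=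
  u * Equiv.addRight 1 * u⁻¹

theorem semiconj_fullCycle (u : Perm (Fin n)) : Semiconj u (· + 1) (fullCycle u) := fun i => by
  simp [fullCycle]

theorem exists_iterate_add_one_eq (i j : Fin n) : ∃ m, (· + 1)^[m] i = j := by
  have hval (m : ℕ) : (((· + 1)^[m] i : Fin n) : ℕ) = (i + m) % n := by
    induction m with
    | zero => simp [Nat.mod_eq_of_lt]
    | succ m ih =>
      simp only [iterate_succ_apply', Fin.val_add, ih, Fin.val_one', Nat.add_mod_mod,
        Nat.mod_add_mod, add_assoc]
  refine ⟨n - i + j, Fin.ext ?_⟩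
  rw [hval, ← add_assoc, Nat.add_sub_cancel' i.2.le, Nat.add_mod_left, Nat.mod_eq_of_lt j.2]

theorem exists_iterate_fullCycle_eq (u : Perm (Fin n)) (x y : Fin n) :
    ∃ m, (fullCycle u)^[m] x = y := by
  obtain ⟨m, hm⟩ := exists_iterate_add_one_eq (u⁻¹ x) (u⁻¹ y)
  have hiter := (semiconj_fullCycle u).iterate_right m (u⁻¹ x)
  rw [hm] at hiter
  exact ⟨m, by simpa using hiter.symm⟩

theorem isFullCycle_fullCycle (u : Perm (Fin n)) : IsFullCycle (fullCycle u) := by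
  refine ⟨Set.bijOn_univ.2 (fullCycle u).bijective, fun x _ y _ => ?_⟩
  obtain ⟨m, hm⟩ := exists_iterate_fullCycle_eq u x y
  exact ⟨m, by rw [zpow_natCast, ← Perm.iterate_eq_pow, hm]⟩

theorem fullCycle_injective_of_apply_zero_eq {u v : Perm (Fin n)} (h0 : u 0 = v 0)
    (h : fullCycle u = fullCycle v) : u = v := by
  ext1 i
  obtain ⟨m, rfl⟩ := exists_iterate_add_one_eq 0 i
  rw [(semiconj_fullCycle u).iterate_right m, (semiconj_fullCycle v).iterate_right m, h, h0]

theorem IsFullCycle.exists_fullCycle_eq {π : Perm (Fin n)} (hπ : IsFullCycle π) (k : Fin n) :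
    ∃ u, u 0 = k ∧ fullCycle u = π := by
  have hcycle : π.IsCycleOn (univ : Finset (Fin n)) := by simpa [IsFullCycle] using hπ
  have hpow (i j : ℕ) : (π ^ i) k = (π ^ j) k ↔ i ≡ j [MOD n] := by
    simpa using hcycle.pow_apply_eq_pow_apply (mem_univ k) (m := i) (n := j)
  have hinj : Injective fun i : Fin n => (π ^ (i : ℕ)) k := fun i j hij =>
    Fin.ext (Nat.ModEq.eq_of_lt_of_lt ((hpow i j).1 hij) i.2 j.2)
  let u : Perm (Fin n) := Equiv.ofBijective _ (Finite.injective_iff_bijective.1 hinj)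
  have hu (i : Fin n) : u i = (π ^ (i : ℕ)) k := rfl
  refine ⟨u, by simp [hu], ?_⟩
  ext1 x
  obtain ⟨i, rfl⟩ := u.surjective x
  rw [← (semiconj_fullCycle u).eq i, hu, hu, ← Perm.mul_apply, ← pow_succ', hpow]
  simp [Nat.ModEq, Fin.val_add]

end FullCycle

section Sorting

variable {n : ℕ} {κ : Type*} [LinearOrder κ] {c : Fin n → κ}

theorem comp_inv_sort_eq {γ : Type*} [LinearOrder γ] (hc : Monotone c) (u : Perm (Fin n))
    {key : Fin n → γ} (hkey : ∀ i j, key i ≤ key j → c (u i) ≤ c (u j)) :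
    c ∘ ⇑(Tuple.sort key)⁻¹ = c ∘ u := by
  have hsorted : Monotone (c ∘ ⇑(u * Tuple.sort key)) := fun i j hij =>
    hkey _ _ (Tuple.monotone_sort key hij)
  have hone : Monotone (c ∘ ⇑(1 : Perm (Fin n))) := hc
  have hcomp : c ∘ ⇑(u * Tuple.sort key) = c := Tuple.unique_monotone hsorted hone
  funext i
  simpa using (congrFun hcomp ((Tuple.sort key)⁻¹ i)).symm

theorem ncard_inv_eq_sort {γ γ' : Type*} [LinearOrder γ] [LinearOrder γ'] (hc : Monotone c)
    {key : (Fin n → κ) → Fin n → γ} (hkey : ∀ w i j, key w i ≤ key w j → w i ≤ w j)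
    {key' : (Fin n → κ) → Fin n → γ'} (hkey' : ∀ w i j, key' w i ≤ key' w j → w i ≤ w j)
    (P : (Fin n → κ) → Prop) :
    {u : Perm (Fin n) | P (c ∘ u) ∧ u⁻¹ = Tuple.sort (key (c ∘ u))}.ncard =
      {u : Perm (Fin n) | P (c ∘ u) ∧ u⁻¹ = Tuple.sort (key' (c ∘ u))}.ncard := by
  have hword (u : Perm (Fin n)) : c ∘ ⇑(Tuple.sort (key (c ∘ u)))⁻¹ = c ∘ u :=
    comp_inv_sort_eq hc u (hkey _)
  have hword' (u : Perm (Fin n)) : c ∘ ⇑(Tuple.sort (key' (c ∘ u)))⁻¹ = c ∘ u :=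
    comp_inv_sort_eq hc u (hkey' _)
  refine (Set.InvOn.bijOn (f := fun u : Perm (Fin n) => (Tuple.sort (key' (c ∘ u)))⁻¹)
    (f' := fun u : Perm (Fin n) => (Tuple.sort (key (c ∘ u)))⁻¹) ⟨?_, ?_⟩ ?_ ?_).ncard_eq
  · rintro u ⟨-, hu⟩
    simp only [hword', ← hu, inv_inv]
  · rintro u ⟨-, hu⟩
    simp only [hword, ← hu, inv_inv]
  · rintro u ⟨hP, -⟩
    simp only [Set.mem_ofPred_eq, hword', inv_inv, hP, and_self]
  · rintro u ⟨hP, -⟩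
    simp only [Set.mem_ofPred_eq, hword, inv_inv, hP, and_self]

theorem inv_eq_sort_comp_iff (hc : Monotone c) (u : Perm (Fin n)) :
    u⁻¹ = Tuple.sort (c ∘ u) ↔ StrictMonoOnFibers c ⇑u⁻¹ := by
  have hcomp : (c ∘ u) ∘ ⇑u⁻¹ = c := by ext; simp
  rw [Tuple.eq_sort_iff, hcomp]
  simp [hc, StrictMonoOnFibers]

theorem inv_eq_sort_itinerary_iff [NeZero n] (hc : Monotone c) {k : Fin n}
    (hck : ∀ x, c x = c k → x = k) (u : Perm (Fin n)) :
    u⁻¹ = Tuple.sort (itinerary (c ∘ u) (· + 1)) ↔ StrictMonoOnFibers c (fullCycle u) := by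
  have hcomp : itinerary (c ∘ u) (· + 1) ∘ ⇑u⁻¹ = itinerary c (fullCycle u) := by
    ext1 x
    simpa using (itinerary_apply_of_semiconj (semiconj_fullCycle u) (u⁻¹ x)).symm
  have hinj : Injective (itinerary c (fullCycle u)) :=
    itinerary_injective (fullCycle u).injective hck fun x => exists_iterate_fullCycle_eq u x k
  rw [Tuple.eq_sort_iff, hcomp]
  refine ⟨fun h => strictMonoOnFibers_of_strictMono_itinerary (h.1.strictMono_of_injective hinj),
    fun h => ⟨h.monotone_itinerary hc, fun x y hxy hxy' => ?_⟩⟩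
  exact absurd (hinj ((congrFun hcomp x).symm.trans (hxy'.trans (congrFun hcomp y)))) hxy.ne

theorem ncard_strictMonoOnFibers_fullCycle [NeZero n] (hc : Monotone c) {k : Fin n}
    (hck : ∀ x, c x = c k → x = k) :
    {u : Perm (Fin n) | u 0 = k ∧ StrictMonoOnFibers c (fullCycle u)}.ncard =
      {u : Perm (Fin n) | u 0 = k ∧ StrictMonoOnFibers c ⇑u⁻¹}.ncard := by
  have hcolor (u : Perm (Fin n)) : u 0 = k ↔ (c ∘ u) 0 = c k := ⟨congrArg c, hck (u 0)⟩
  simp only [hcolor, ← inv_eq_sort_comp_iff hc, ← inv_eq_sort_itinerary_iff hc hck]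
  exact ncard_inv_eq_sort (key := fun w => itinerary w (· + 1)) (key' := fun w => w) hc
    (fun _ _ _ => apply_le_of_itinerary_le) (fun _ _ _ => id) fun w => w 0 = c k

end Sorting

section Blocks

variable {n : ℕ} {J : Set ℕ} {a : Fin n → ℤ} {k x y : Fin n}

open Classical in
/-- The index of the block containing the position `x`, when the word is cut before the (0-based)
position `i` for every `i ∈ J`, that is, exactly where `descentSet` records a descent `i`. -/
noncomputable def blockIndex (J : Set ℕ) (x : Fin n) : ℕ :=
  Nat.count (· ∈ J) (x + 1)

open Classical in
theorem blockIndex_monotone (J : Set ℕ) : Monotone (blockIndex (n := n) J) := fun _ _ hxy =>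
  Nat.count_monotone _ (Nat.succ_le_succ hxy)

open Classical in
theorem blockIndex_lt_iff : blockIndex J x < blockIndex J y ↔ ∃ i ∈ J, (x : ℕ) < i ∧ i ≤ y := by
  constructor
  · intro h
    obtain ⟨i, ⟨hxi, hiy⟩, hi⟩ := Nat.exists_of_count_lt_count h
    exact ⟨i, hi, hxi, Nat.lt_succ_iff.1 hiy⟩
  · rintro ⟨i, hi, hxi, hiy⟩
    exact (Nat.count_monotone _ hxi).trans_lt (Nat.count_strict_mono hi (Nat.lt_succ_iff.2 hiy))

theorem descentSet_subset_iff_strictMonoOnFibers (ha : Injective a) :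
    descentSet a ⊆ J ↔ StrictMonoOnFibers (blockIndex J) a := by
  constructor
  · intro hJ x y hxy hblock
    have hle (m : ℕ) (hxm : x ≤ m) : ∀ hmy : m ≤ y, a x ≤ a ⟨m, hmy.trans_lt y.2⟩ := by
      induction m, hxm using Nat.le_induction with
      | base => exact fun _ => le_rfl
      | succ m hxm ih =>
        refine fun hmy => (ih (by omega)).trans (not_lt.1 fun hdesc => ?_)
        have hmem : m + 1 ∈ J := hJ ⟨by omega, by omega, hdesc⟩
        exact (blockIndex_lt_iff.2 ⟨m + 1, hmem, by omega, hmy⟩).ne hblock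
    exact (hle y hxy.le le_rfl).lt_of_ne (ha.ne hxy.ne)
  · rintro hmono i ⟨hi, hin, hdesc⟩
    by_contra hiJ
    have hlt : (⟨i - 1, by omega⟩ : Fin n) < ⟨i, hin⟩ := Fin.mk_lt_mk.2 (by omega)
    refine hdesc.not_gt (hmono hlt ((blockIndex_monotone J hlt.le).eq_of_not_lt fun hblock => ?_))
    obtain ⟨l, hl, hil, hli⟩ := blockIndex_lt_iff.1 hblock
    obtain rfl : l = i := by simp only at hil hli; omega
    exact hiJ hl

/-- The blocks cut at `J` and on both sides of the position `k`, so that `k` is alone in its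
block. -/
noncomputable def isolatingBlockIndex (k : Fin n) (J : Set ℕ) : Fin n → ℕ :=
  blockIndex (insert (k : ℕ) (insert (k + 1 : ℕ) J))

theorem eq_of_isolatingBlockIndex_eq (h : isolatingBlockIndex k J x = isolatingBlockIndex k J k) :
    x = k := by
  rcases lt_trichotomy x k with hx | hx | hx
  · exact absurd h (blockIndex_lt_iff.2 ⟨k, by simp, hx, le_rfl⟩).ne
  · exact hx
  · exact absurd h (blockIndex_lt_iff.2 ⟨k + 1, by simp, Nat.lt_succ_self _, hx⟩).ne'

theorem mem_descentSet_of_forall_lt (hmin : ∀ x, x ≠ k → a k < a x) (hk : (k : ℕ) ≠ 0) :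
    (k : ℕ) ∈ descentSet a :=
  ⟨by omega, k.2, hmin _ (Fin.ne_of_val_ne (by simp only; omega))⟩

theorem succ_notMem_descentSet_of_forall_lt (hmin : ∀ x, x ≠ k → a k < a x) :
    (k : ℕ) + 1 ∉ descentSet a := by
  rintro ⟨-, hkn, hdesc⟩
  exact hdesc.not_gt (hmin ⟨k + 1, hkn⟩ (Fin.ne_of_val_ne (by simp)))

theorem descentSet_subset_iff_of_forall_lt (ha : Injective a) (hmin : ∀ x, x ≠ k → a k < a x) :
    descentSet a ⊆ J ↔
      ((k : ℕ) = 0 ∨ (k : ℕ) ∈ J) ∧ StrictMonoOnFibers (isolatingBlockIndex k J) a := by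
  rw [isolatingBlockIndex, ← descentSet_subset_iff_strictMonoOnFibers ha]
  refine ⟨fun hJ => ⟨?_, hJ.trans (by grind)⟩, ?_⟩
  · exact or_iff_not_imp_left.2 fun hk => hJ (mem_descentSet_of_forall_lt hmin hk)
  · rintro ⟨hk, hJ⟩ i hi
    rcases hJ hi with rfl | rfl | hiJ
    · exact hk.resolve_left (Nat.one_le_iff_ne_zero.1 hi.1)
    · exact absurd hi (succ_notMem_descentSet_of_forall_lt hmin)
    · exact hiJ

end Blocks

section OneLine

variable {n : ℕ}

theorem oneLine_lt_oneLine {π : Perm (Fin n)} {x y : Fin n} :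
    oneLine π x < oneLine π y ↔ π x < π y := by
  simp [oneLine]

theorem oneLine_injective (π : Perm (Fin n)) : Injective (oneLine π) := fun x y hxy => by
  simpa [oneLine, Fin.val_inj] using hxy

theorem oneLine_pos (π : Perm (Fin n)) (x : Fin n) : 0 < oneLine π x := by
  simp only [oneLine]
  omega

variable [NeZero n]

/-- The element of `T⁰_n` obtained from the `n`-cycle `(u 0, u 1, …, u (n - 1))` by replacing its
entry in position `u 0` with `0`. Every element of `T⁰_n` arises from exactly one `u`. -/
def zeroedCycle (u : Perm (Fin n)) : Fin n → ℤ :=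
  update (oneLine (fullCycle u)) (u 0) 0

theorem zeroedCycle_apply_eq_zero_iff {u : Perm (Fin n)} {x : Fin n} :
    zeroedCycle u x = 0 ↔ x = u 0 := by
  refine ⟨not_imp_not.1 fun hx => ?_, fun hx => ?_⟩
  · rw [zeroedCycle, update_of_ne hx]
    exact (oneLine_pos _ x).ne'
  · rw [hx, zeroedCycle, update_self]

theorem zeroedCycle_zero_lt (u : Perm (Fin n)) (x : Fin n) (hx : x ≠ u 0) :
    zeroedCycle u (u 0) < zeroedCycle u x := by
  simp [zeroedCycle, hx, oneLine_pos]

theorem zeroedCycle_apply_injective (u : Perm (Fin n)) : Injective (zeroedCycle u) := by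
  intro x y hxy
  by_cases hx : zeroedCycle u x = 0
  · have hy : zeroedCycle u y = 0 := hxy.symm.trans hx
    rw [zeroedCycle_apply_eq_zero_iff.1 hx, zeroedCycle_apply_eq_zero_iff.1 hy]
  · have hy : ¬zeroedCycle u y = 0 := fun hy => hx (hxy.trans hy)
    rw [zeroedCycle_apply_eq_zero_iff] at hx hy
    exact oneLine_injective (fullCycle u) (by simpa [zeroedCycle, hx, hy] using hxy)

theorem oneLine_inv_zero_lt (u : Perm (Fin n)) (x : Fin n) (hx : x ≠ u 0) :
    oneLine u⁻¹ (u 0) < oneLine u⁻¹ x := by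
  rw [oneLine_lt_oneLine, Perm.inv_eq_iff_eq.2 rfl, Fin.pos_iff_ne_zero]
  exact fun h => hx (Perm.inv_eq_iff_eq.1 h)

theorem ncard_descentSet_zeroedCycle_subset (k : Fin n) (J : Set ℕ) :
    {u : Perm (Fin n) | u 0 = k ∧ descentSet (zeroedCycle u) ⊆ J}.ncard =
      {u : Perm (Fin n) | u 0 = k ∧ descentSet (oneLine u⁻¹) ⊆ J}.ncard := by
  set c := isolatingBlockIndex k J
  have hck (x : Fin n) : c x = c k → x = k := eq_of_isolatingBlockIndex_eq
  have hcycle (u : Perm (Fin n)) : u 0 = k ∧ descentSet (zeroedCycle u) ⊆ J ↔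
      ((k : ℕ) = 0 ∨ (k : ℕ) ∈ J) ∧ u 0 = k ∧ StrictMonoOnFibers c (fullCycle u) := by
    rw [and_left_comm]
    refine and_congr_right ?_
    rintro rfl
    rw [descentSet_subset_iff_of_forall_lt (zeroedCycle_apply_injective u) (zeroedCycle_zero_lt u),
      zeroedCycle, strictMonoOnFibers_update_iff hck]
    simp only [StrictMonoOnFibers, oneLine_lt_oneLine, c]
  have hline (u : Perm (Fin n)) : u 0 = k ∧ descentSet (oneLine u⁻¹) ⊆ J ↔
      ((k : ℕ) = 0 ∨ (k : ℕ) ∈ J) ∧ u 0 = k ∧ StrictMonoOnFibers c ⇑u⁻¹ := by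
    rw [and_left_comm]
    refine and_congr_right ?_
    rintro rfl
    rw [descentSet_subset_iff_of_forall_lt (oneLine_injective u⁻¹) (oneLine_inv_zero_lt u)]
    simp only [StrictMonoOnFibers, oneLine_lt_oneLine, c]
  simp only [hcycle, hline]
  by_cases hk : (k : ℕ) = 0 ∨ (k : ℕ) ∈ J
  · simp only [hk, true_and]
    exact ncard_strictMonoOnFibers_fullCycle (blockIndex_monotone _) hck
  · simp only [hk, false_and]

end OneLine

section Fibers

variable {α β : Type*}

theorem ncard_le_eq_finsum_add_ncard_eq {P : Type*} [PartialOrder P] {s : Set α} (hs : s.Finite)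
    {f : α → P} {T : Set P} (hT : T.Finite) (hfT : Set.MapsTo f s T) (J : P) :
    {a ∈ s | f a ≤ J}.ncard =
      ∑ᶠ I ∈ T ∩ Set.Iio J, {a ∈ s | f a = I}.ncard + {a ∈ s | f a = J}.ncard := by
  have hunion : {a ∈ s | f a < J} = ⋃ I ∈ T ∩ Set.Iio J, {a ∈ s | f a = I} := by
    ext a
    simpa using fun ha _ => hfT ha
  have hdisj : (T ∩ Set.Iio J).PairwiseDisjoint fun I => {a ∈ s | f a = I} :=
    fun I _ I' _ hII' => Set.disjoint_left.2 fun a ha ha' => hII' (ha.2.symm.trans ha'.2)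
  have hsplit : {a ∈ s | f a ≤ J} = {a ∈ s | f a < J} ∪ {a ∈ s | f a = J} := by
    ext a
    simp only [Set.mem_ofPred_eq, Set.mem_union, le_iff_lt_or_eq, and_or_left]
  rw [hsplit, Set.ncard_union_eq
      (Set.disjoint_left.2 fun a ha ha' => ha.2.ne ha'.2) (hs.sep _) (hs.sep _),
    hunion, (hT.inter_of_left _).ncard_biUnion (fun _ _ => hs.sep _) hdisj]

theorem ncard_eq_of_forall_ncard_le_eq {P : Type*} [PartialOrder P] {s : Set α} {t : Set β}
    (hs : s.Finite) (ht : t.Finite) {f : α → P} {g : β → P}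
    (h : ∀ J, {a ∈ s | f a ≤ J}.ncard = {b ∈ t | g b ≤ J}.ncard) (J : P) :
    {a ∈ s | f a = J}.ncard = {b ∈ t | g b = J}.ncard := by
  by_contra hJ
  set T := f '' s ∪ g '' t
  have hT : T.Finite := (hs.image f).union (ht.image g)
  have hbad : {I | {a ∈ s | f a = I}.ncard ≠ {b ∈ t | g b = I}.ncard} ⊆ T := by
    intro I hI
    by_contra hIT
    have hsI : {a ∈ s | f a = I} = ∅ :=
      Set.eq_empty_of_forall_notMem fun a ha => hIT (.inl ⟨a, ha⟩)
    have htI : {b ∈ t | g b = I} = ∅ :=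
      Set.eq_empty_of_forall_notMem fun b hb => hIT (.inr ⟨b, hb⟩)
    exact hI (by rw [hsI, htI, Set.ncard_empty, Set.ncard_empty])
  obtain ⟨I, hI, hmin⟩ := (hT.subset hbad).exists_minimal ⟨J, hJ⟩
  have hbelow : ∑ᶠ K ∈ T ∩ Set.Iio I, {a ∈ s | f a = K}.ncard =
      ∑ᶠ K ∈ T ∩ Set.Iio I, {b ∈ t | g b = K}.ncard :=
    finsum_mem_congr rfl fun K hK => not_not.1 fun hK' => (hmin hK' hK.2.le).not_gt hK.2
  have hle := h I
  rw [ncard_le_eq_finsum_add_ncard_eq hs hT fun a ha => .inl ⟨a, ha, rfl⟩,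
    ncard_le_eq_finsum_add_ncard_eq ht hT fun b hb => .inr ⟨b, hb, rfl⟩, hbelow] at hle
  exact hI (Nat.add_left_cancel hle)

theorem exists_equiv_of_ncard_fiber_eq [Finite α] [Finite β] {κ : Type*} {f : α → κ} {g : β → κ}
    (h : ∀ i, {a | f a = i}.ncard = {b | g b = i}.ncard) : ∃ e : α ≃ β, ∀ a, g (e a) = f a := by
  let e (i : κ) : {a // f a = i} ≃ {b // g b = i} := (Finite.card_eq.1 (h i)).some
  exact ⟨Equiv.ofFiberEquiv e, Equiv.ofFiberEquiv_map e⟩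

theorem perm_eq_of_forall_ne {π π' : Perm α} {k : α} (h : ∀ x, x ≠ k → π x = π' x) : π = π' := by
  have hk : π k = π' k := by
    obtain ⟨y, hy⟩ := π'.surjective (π k)
    by_cases hyk : y = k
    · rw [← hy, hyk]
    · exact absurd (π.injective ((h y hyk).trans hy)) hyk
  ext1 x
  by_cases hx : x = k
  · rw [hx, hk]
  · exact h x hx

end Fibers

section Bijection

variable (n : ℕ) [NeZero n]

theorem exists_equiv_descentSet_zeroedCycle :
    ∃ e : Perm (Fin n) ≃ Perm (Fin n), ∀ u,
      (e u) 0 = u 0 ∧ descentSet (oneLine (e u)⁻¹) = descentSet (zeroedCycle u) := by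
  have hfiber (k : Fin n) (I : Set ℕ) :
      {u : Perm (Fin n) | u 0 = k ∧ descentSet (zeroedCycle u) = I}.ncard =
        {u : Perm (Fin n) | u 0 = k ∧ descentSet (oneLine u⁻¹) = I}.ncard :=
    ncard_eq_of_forall_ncard_le_eq (Set.toFinite {u : Perm (Fin n) | u 0 = k}) (Set.toFinite _)
      (ncard_descentSet_zeroedCycle_subset k) I
  obtain ⟨e, he⟩ := exists_equiv_of_ncard_fiber_eq
    (f := fun u : Perm (Fin n) => (u 0, descentSet (zeroedCycle u)))
    (g := fun u : Perm (Fin n) => (u 0, descentSet (oneLine u⁻¹)))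
    fun ⟨k, I⟩ => by simpa only [Prod.mk.injEq] using hfiber k I
  exact ⟨e, fun u => Prod.mk.inj (he u)⟩

theorem zeroedCycle_injective : Injective (zeroedCycle (n := n)) := by
  intro u v huv
  have h0 : u 0 = v 0 := by
    rw [← zeroedCycle_apply_eq_zero_iff, ← huv, zeroedCycle_apply_eq_zero_iff]
  refine fullCycle_injective_of_apply_zero_eq h0 (perm_eq_of_forall_ne (k := u 0) fun x hx => ?_)
  have hx' : x ≠ v 0 := h0 ▸ hx
  simpa [zeroedCycle, oneLine, hx, hx', Fin.val_inj] using congrFun huv x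

theorem range_zeroedCycle : Set.range (zeroedCycle (n := n)) = T0 n := by
  ext τ
  constructor
  · rintro ⟨u, rfl⟩
    exact ⟨fullCycle u, isFullCycle_fullCycle u, u 0, rfl⟩
  · rintro ⟨π, hπ, k, rfl⟩
    obtain ⟨u, rfl, rfl⟩ := hπ.exists_fullCycle_eq k
    exact ⟨u, rfl⟩

theorem exists_equiv_T0 :
    ∃ β : T0 n ≃ Perm (Fin n), ∀ τ : T0 n,
      descentSet (τ : Fin n → ℤ) = descentSet (oneLine (β τ)) ∧
        ∀ k : Fin n, (τ : Fin n → ℤ) k = 0 → oneLine (β τ) k = 1 := by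
  obtain ⟨e, he⟩ := exists_equiv_descentSet_zeroedCycle n
  let ψ : Perm (Fin n) ≃ T0 n :=
    (Equiv.ofInjective _ (zeroedCycle_injective n)).trans (Equiv.setCongr (range_zeroedCycle n))
  refine ⟨ψ.symm.trans (e.trans (Equiv.inv _)), fun τ => ?_⟩
  obtain ⟨u, rfl⟩ := ψ.surjective τ
  have hψ : (ψ u : Fin n → ℤ) = zeroedCycle u := rfl
  have hβ : (ψ.symm.trans (e.trans (Equiv.inv _))) (ψ u) = (e u)⁻¹ := by simp
  rw [hβ, hψ]
  refine ⟨(he u).2.symm, fun k hk => ?_⟩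
  rw [zeroedCycle_apply_eq_zero_iff.1 hk, oneLine, ← (he u).1, Perm.inv_eq_iff_eq.2 rfl]
  simp

end Bijection

end CyclicDescent

theorem corollary3 (n : ℕ) (hn : 1 ≤ n) :
    (∃ β : CyclicDescent.T0 n ≃ Equiv.Perm (Fin n), ∀ τ : CyclicDescent.T0 n,
      CyclicDescent.descentSet (τ : Fin n → ℤ) =
          CyclicDescent.descentSet (CyclicDescent.oneLine (β τ)) ∧
        ∀ k : Fin n, (τ : Fin n → ℤ) k = 0 → CyclicDescent.oneLine (β τ) k = 1) ∧
    (∀ I : Set ℕ, I ⊆ Set.Icc 1 (n - 1) →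
      Set.ncard {τ : Fin n → ℤ | τ ∈ CyclicDescent.T0 n ∧ CyclicDescent.descentSet τ = I} =
        Set.ncard {σ : Equiv.Perm (Fin n) |
          CyclicDescent.descentSet (CyclicDescent.oneLine σ) = I}) := by
  have : NeZero n := ⟨by omega⟩
  obtain ⟨β, hβ⟩ := CyclicDescent.exists_equiv_T0 n
  refine ⟨⟨β, hβ⟩, fun I _ => Set.ncard_congr (fun τ hτ => β ⟨τ, hτ.1⟩) ?_ ?_ ?_⟩
  · rintro τ ⟨hτ, rfl⟩
    exact (hβ ⟨τ, hτ⟩).1.symm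
  · intro τ τ' hτ hτ' h
    exact congrArg Subtype.val (β.injective h)
  · rintro σ rfl
    exact ⟨β.symm σ, ⟨(β.symm σ).2, by rw [(hβ _).1, β.apply_symm_apply]⟩, by simp⟩
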